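/- Let $\theta,\delta,\lambda$ be non-negative integers with $\delta\ge 1$ and $\lambda=\theta-\delta\ge 0$. Consider an urn with balls of four colours $x,u,y,w$, initially $a_0,d_0,b_0,c_0\ge 0$ balls of these colours, and reinforcement matrix (rows and columns in the order $x,u,y,w$) $$RM_2=\begin{pmatrix}1+\theta&0&0&0\\ \theta&1&0&0\\ 0&0&1+\delta&\lambda\\ 0&0&0&1+\theta\end{pmatrix}.$$ At each step one ball is drawn and taken out, and the balls listed in the row of its colour are put in. An urn history of length $n$ is a sequence of $n$ successive draws of individual (distinguishable) balls. Let $f_n(x,u,y,w)=\sum x^{X}u^{U}y^{Y}w^{W}$, where the sum runs over all histories of length $n$ and $X,U,Y,W$ are the numbers of balls of the four colours at the end of the history, and let $H(z;x,u,y,w)=\sum_{n\ge 0}f_n(x,u,y,w)\,z^n/n!$ be the generating function of urn histories. Then, for all complex $x,u,y,w$ with $w\ne 0$ and all complex $z$ in some neighbourhood of $0$ (which may depend on all the other data), the series converges absolutely and $$H(z;x,u,y,w)=x^{a_0}u^{d_0}y^{b_0}w^{c_0}\,(1-\theta x^{\theta}z)^{-\frac{a_0+d_0}{\theta}}\,(1-\theta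 w^{\theta}z)^{-\frac{c_0}{\theta}}\,\Bigl(1-y^{\delta}w^{-\delta}\bigl(1-(1-\theta w^{\theta}z)^{\frac{\delta}{\theta}}\bigr)\Bigr)^{-\frac{b_0}{\delta}},$$ where the fractional powers are principal values, equal to $1$ at $z=0$. -/

import Mathlib

/-- Composition of an urn after one draw: `c j` is the number of balls of colour `j`. The drawn ball
(of colour `i`) is taken out, and the balls listed in row `i` of the reinforcement matrix `M` are put
in. (A diagonal entry `1 + θ` therefore means that the drawn ball is put back with `θ` more.) -/
def urnStep {k : ℕ} (M : Matrix (Fin k) (Fin k) ℕ) (c : Fin k → ℕ) (i : Fin k) : Fin k → ℕ :=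
  fun j => (c j - if j = i then 1 else 0) + M i j

/-- The balls of an urn of composition `c`; all balls are distinguishable. -/
abbrev UrnBall {k : ℕ} (c : Fin k → ℕ) : Type := Σ i : Fin k, Fin (c i)

/-- Urn histories of length `n` that start from the composition `c`: the sequences of `n` successive
draws of individual balls. -/
def UrnHistory {k : ℕ} (M : Matrix (Fin k) (Fin k) ℕ) : ℕ → (Fin k → ℕ) → Type
  | 0, _ => Unit
  | n + 1, c => Σ b : UrnBall c, UrnHistory M n (urnStep M c b.1)

instance instFintypeUrnHistory {k : ℕ} (M : Matrix (Fin k) (Fin k) ℕ) :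
    (n : ℕ) → (c : Fin k → ℕ) → Fintype (UrnHistory M n c)
  | 0, _ => inferInstanceAs (Fintype Unit)
  | n + 1, c =>
    letI : ∀ b : UrnBall c, Fintype (UrnHistory M n (urnStep M c b.1)) :=
      fun b => instFintypeUrnHistory M n (urnStep M c b.1)
    inferInstanceAs (Fintype (Σ b : UrnBall c, UrnHistory M n (urnStep M c b.1)))

/-- The composition of the urn at the end of a history. -/
def UrnHistory.final {k : ℕ} {M : Matrix (Fin k) (Fin k) ℕ} :
    {n : ℕ} → {c : Fin k → ℕ} → UrnHistory M n c → (Fin k → ℕ)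
  | 0, c, _ => c
  | _ + 1, _, ⟨_, h⟩ => UrnHistory.final h

/-- The counting polynomial `f_n`, evaluated at `v`: each history of length `n` contributes the
monomial `∏ j, v j ^ (number of balls of colour j at the end of the history)`. -/
noncomputable def urnCount {k : ℕ} (M : Matrix (Fin k) (Fin k) ℕ) (c : Fin k → ℕ) (n : ℕ)
    (v : Fin k → ℂ) : ℂ :=
  ∑ h : UrnHistory M n c, ∏ j, v j ^ h.final j

/-- The generating function of urn histories, `H(z; v) = ∑ₙ fₙ(v) zⁿ / n!`. -/
noncomputable def urnGF {k : ℕ} (M : Matrix (Fin k) (Fin k) ℕ) (c : Fin k → ℕ) (z : ℂ)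
    (v : Fin k → ℂ) : ℂ :=
  ∑' n : ℕ, urnCount M c n v * z ^ n / (Nat.factorial n : ℂ)

/-- The reinforcement matrix of the four-colour urn; the colours are `x, u, y, w`, in this order. -/
def urnRM₂ (θ δ lam : ℕ) : Matrix (Fin 4) (Fin 4) ℕ :=
  !![1 + θ, 0, 0, 0;
     θ, 1, 0, 0;
     0, 0, 1 + δ, lam;
     0, 0, 0, 1 + θ]

/-! A draw acts on monomials as the operator `∑ i, (∏ j, v j ^ M i j) ∂ᵢ`. Along a solution `V` of
`V i' = ∏ j, V j ^ M i j` this operator is `d/dt`, so the `n`-th derivative at `0` of the initial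
monomial along `V` is `fₙ(V 0)`, and Taylor's theorem sums the series (`hasSum_urnCount`). For
`urnRM₂` the system is triangular: `x' = x^(1+θ)`, `u' = x^θ u` and `w' = w^(1+θ)` are solved by
powers of linear functions; then `y' = y^(1+δ) w^lam` separates, and `C` is its integral. -/

lemma urnCount_zero {k : ℕ} (M : Matrix (Fin k) (Fin k) ℕ) (c : Fin k → ℕ) (v : Fin k → ℂ) :
    urnCount M c 0 v = ∏ j, v j ^ c j := by
  change ∑ _h : Unit, ∏ j, v j ^ c j = _
  simp

lemma urnCount_succ {k : ℕ} (M : Matrix (Fin k) (Fin k) ℕ) (c : Fin k → ℕ) (n : ℕ)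
    (v : Fin k → ℂ) :
    urnCount M c (n + 1) v = ∑ i, (c i : ℂ) * urnCount M (urnStep M c i) n v := by
  change ∑ h : (Σ b : UrnBall c, UrnHistory M n (urnStep M c b.1)),
    ∏ j, v j ^ (UrnHistory.final h.2) j = _
  rw [Fintype.sum_sigma, Fintype.sum_sigma]
  refine Finset.sum_congr rfl fun i _ => ?_
  change ∑ _ : Fin (c i), urnCount M (urnStep M c i) n v = _
  simp

/-- The monomial of a composition, evaluated along a solution of the isochronal system
`V i' = ∏ j, V j ^ M i j`, has as derivative the sum over all draws. -/
lemma hasDerivAt_prod_pow_urn {k : ℕ} {M : Matrix (Fin k) (Fin k) ℕ} {V : ℂ → Fin k → ℂ} {z : ℂ}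
    (hV : ∀ i, HasDerivAt (fun t => V t i) (∏ j, V z j ^ M i j) z) (c : Fin k → ℕ) :
    HasDerivAt (fun t => ∏ j, V t j ^ c j)
      (∑ i, (c i : ℂ) * ∏ j, V z j ^ urnStep M c i j) z := by
  have h := HasDerivAt.fun_finsetProd (u := Finset.univ) (f := fun j t => V t j ^ c j)
    (fun i _ => (hV i).pow (c i))
  refine h.congr_deriv (Finset.sum_congr rfl fun i _ => ?_)
  have hrest : ∏ j ∈ Finset.univ.erase i, V z j ^ (c j - if j = i then 1 else 0)
      = ∏ j ∈ Finset.univ.erase i, V z j ^ c j :=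
    Finset.prod_congr rfl fun j hj => by simp [Finset.ne_of_mem_erase hj]
  -- If `c i = 0`, the truncated exponent `c i - 1` is harmless: the factor `c i` kills the term.
  simp only [urnStep, pow_add, Finset.prod_mul_distrib]
  rw [← Finset.mul_prod_erase Finset.univ (fun j => V z j ^ (c j - if j = i then 1 else 0))
    (Finset.mem_univ i), hrest]
  simp only [if_true, smul_eq_mul]
  ring

/-- The recursion splits off the first draw and is linear, so differentiation passes down to length
`0`, where it adds one last draw. -/
lemma hasDerivAt_urnCount {k : ℕ} {M : Matrix (Fin k) (Fin k) ℕ} {V : ℂ → Fin k → ℂ} {z : ℂ}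
    (hV : ∀ i, HasDerivAt (fun t => V t i) (∏ j, V z j ^ M i j) z) (n : ℕ) (c : Fin k → ℕ) :
    HasDerivAt (fun t => urnCount M c n (V t)) (urnCount M c (n + 1) (V z)) z := by
  induction n generalizing c with
  | zero =>
    simp only [urnCount_succ, urnCount_zero]
    exact hasDerivAt_prod_pow_urn hV c
  | succ n ih =>
    rw [urnCount_succ M c (n + 1)]
    simp only [urnCount_succ M c n]
    exact HasDerivAt.fun_sum fun i _ => (ih (urnStep M c i)).const_mul (c i : ℂ)

/-- If `V` solves the isochronal system on a disc around `0`, then the generating function of urn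
histories converges there to the monomial of the initial composition evaluated along `V`. -/
theorem hasSum_urnCount {k : ℕ} {M : Matrix (Fin k) (Fin k) ℕ} {V : ℂ → Fin k → ℂ} {r : ℝ}
    (hV : ∀ z ∈ Metric.ball (0 : ℂ) r, ∀ i,
      HasDerivAt (fun t => V t i) (∏ j, V z j ^ M i j) z)
    (c : Fin k → ℕ) {z : ℂ} (hz : z ∈ Metric.ball (0 : ℂ) r) :
    HasSum (fun n : ℕ => urnCount M c n (V 0) * z ^ n / (Nat.factorial n : ℂ))
      (∏ j, V z j ^ c j) := by
  have hr : 0 < r := Metric.pos_of_mem_ball hz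
  have hiter : ∀ n : ℕ, ∀ t ∈ Metric.ball (0 : ℂ) r,
      iteratedDeriv n (fun s => ∏ j, V s j ^ c j) t = urnCount M c n (V t) := by
    intro n
    induction n with
    | zero => intro t _; simp [urnCount_zero]
    | succ n ih =>
      intro t ht
      rw [iteratedDeriv_succ]
      have heq : iteratedDeriv n (fun s => ∏ j, V s j ^ c j)
          =ᶠ[nhds t] fun s => urnCount M c n (V s) :=
        Filter.eventually_of_mem (Metric.isOpen_ball.mem_nhds ht) ih
      rw [heq.deriv_eq]
      exact (hasDerivAt_urnCount (hV t ht) n c).deriv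
  have hd : DifferentiableOn ℂ (fun s => ∏ j, V s j ^ c j) (Metric.ball 0 r) := fun t ht =>
    (hasDerivAt_prod_pow_urn (hV t ht) c).differentiableAt.differentiableWithinAt
  refine (Complex.hasSum_taylorSeries_on_ball hd hz).congr_fun fun n => ?_
  rw [hiter n 0 (Metric.mem_ball_self hr), sub_zero, smul_eq_mul, smul_eq_mul]
  ring

/-- The shape shared by all four coordinates: logarithmic derivative `D / f`, stated without
division by `a`, which may vanish. -/
lemma hasDerivAt_mul_cpow_neg_inv {a b D : ℂ} {f : ℂ → ℂ} {z : ℂ} (hb : b ≠ 0)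
    (hf : HasDerivAt f (-b * D) z) (hs : f z ∈ Complex.slitPlane) :
    HasDerivAt (fun t => a * f t ^ (-(1 / b))) (a * f z ^ (-(1 / b)) * (D / f z)) z := by
  have h0 : f z ≠ 0 := Complex.slitPlane_ne_zero hs
  refine ((hf.cpow_const (c := -(1 / b)) hs).const_mul a).congr_deriv ?_
  rw [Complex.cpow_sub _ _ h0, Complex.cpow_one]
  field_simp

lemma mul_cpow_neg_inv_pow {b a s : ℂ} (n : ℕ) :
    (a * s ^ (-(1 / b))) ^ n = a ^ n * s ^ (-((n : ℂ) / b)) := by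
  rw [mul_pow, ← Complex.cpow_nat_mul]
  congr 2
  ring

lemma mul_cpow_neg_inv_pow_self {a s : ℂ} {θ : ℕ} (hθ : θ ≠ 0) :
    (a * s ^ (-(1 / (θ : ℂ)))) ^ θ = a ^ θ / s := by
  rw [mul_cpow_neg_inv_pow, div_self (Nat.cast_ne_zero.2 hθ), Complex.cpow_neg_one, div_eq_mul_inv]

theorem theorem5 (θ δ lam : ℕ) (hδ : 0 < δ) (hbal : (lam : ℤ) = (θ : ℤ) - (δ : ℤ))
    (a₀ d₀ b₀ c₀ : ℕ) (x u y w : ℂ) (hw : w ≠ 0) :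
    ∃ r : ℝ, 0 < r ∧ ∀ z : ℂ, ‖z‖ < r →
      Summable (fun n : ℕ =>
        urnCount (urnRM₂ θ δ lam) ![a₀, d₀, b₀, c₀] n ![x, u, y, w] * z ^ n
          / (Nat.factorial n : ℂ)) ∧
      urnGF (urnRM₂ θ δ lam) ![a₀, d₀, b₀, c₀] z ![x, u, y, w] =
        x ^ a₀ * u ^ d₀ * y ^ b₀ * w ^ c₀
          * (1 - (θ : ℂ) * x ^ θ * z) ^ (-(((a₀ : ℂ) + (d₀ : ℂ)) / (θ : ℂ)))
          * (1 - (θ : ℂ) * w ^ θ * z) ^ (-((c₀ : ℂ) / (θ : ℂ)))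
          * (1 - y ^ δ * w ^ (-(δ : ℤ))
                * (1 - (1 - (θ : ℂ) * w ^ θ * z) ^ ((δ : ℂ) / (θ : ℂ))))
              ^ (-((b₀ : ℂ) / (δ : ℂ))) := by
  have hθdef : θ = lam + δ := by omega
  have hθ : θ ≠ 0 := by omega
  have hθ' : (θ : ℂ) ≠ 0 := Nat.cast_ne_zero.2 hθ
  have hδ' : (δ : ℂ) ≠ 0 := Nat.cast_ne_zero.2 hδ.ne'
  have hlin : ∀ (v z : ℂ), HasDerivAt (fun t : ℂ => 1 - (θ : ℂ) * v ^ θ * t)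
      (-(θ : ℂ) * v ^ θ) z := fun v z => by
    simpa using ((hasDerivAt_id z).const_mul ((θ : ℂ) * v ^ θ)).const_sub 1
  set A : ℂ → ℂ := fun t => 1 - (θ : ℂ) * x ^ θ * t with hA
  set B : ℂ → ℂ := fun t => 1 - (θ : ℂ) * w ^ θ * t with hB
  set C : ℂ → ℂ := fun t => 1 - y ^ δ * w ^ (-(δ : ℤ)) * (1 - B t ^ ((δ : ℂ) / (θ : ℂ))) with hC
  have hA0 : A 0 = 1 := by simp [hA]
  have hB0 : B 0 = 1 := by simp [hB]
  have hC0 : C 0 = 1 := by simp [hC, hB0]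
  have hCd : ∀ z, B z ∈ Complex.slitPlane →
      HasDerivAt C (-(δ : ℂ) * (y ^ δ * (w * B z ^ (-(1 / (θ : ℂ)))) ^ lam)) z := by
    intro z hz
    have hne := Complex.slitPlane_ne_zero hz
    refine (((((hlin w z).cpow_const (c := (δ : ℂ) / θ) hz).const_sub 1).const_mul
      (y ^ δ * w ^ (-(δ : ℤ)))).const_sub 1).congr_deriv ?_
    -- The balance `θ = lam + δ` makes `B ^ (δ / θ)` a primitive of a constant multiple of `B ^
    -- (-lam / θ)`.
    have hexp : (δ : ℂ) / θ - 1 = -((lam : ℂ) / θ) := by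
      field_simp
      rw [hθdef]; push_cast; ring
    rw [mul_cpow_neg_inv_pow, hexp, zpow_neg, zpow_natCast]
    change -(y ^ δ * (w ^ δ)⁻¹ * -((δ : ℂ) / θ * B z ^ (-((lam : ℂ) / θ)) * (-(θ : ℂ) * w ^ θ))) = _
    have hwp : w ^ θ = w ^ lam * w ^ δ := by rw [hθdef, pow_add]
    rw [hwp]
    generalize B z ^ (-((lam : ℂ) / θ)) = s
    field_simp
  have hcont : ∀ f : ℂ → ℂ, ContinuousAt f 0 → f 0 = 1 →
      ∀ᶠ z in nhds (0 : ℂ), f z ∈ Complex.slitPlane := fun f hf h0 =>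
    hf.eventually_mem (Complex.isOpen_slitPlane.mem_nhds (h0 ▸ Complex.one_mem_slitPlane))
  -- Near `0` the three bases stay near `1`, off the branch cut, so the principal powers are
  -- differentiable.
  have hev := (hcont A (hlin x 0).continuousAt hA0).and
    ((hcont B (hlin w 0).continuousAt hB0).and
      (hcont C (hCd 0 (hB0 ▸ Complex.one_mem_slitPlane)).continuousAt hC0))
  obtain ⟨r, hr, hball⟩ := Metric.eventually_nhds_iff_ball.1 hev
  refine ⟨r, hr, fun z hz => ?_⟩
  set V : ℂ → Fin 4 → ℂ := fun t =>
    ![x * A t ^ (-(1 / (θ : ℂ))), u * A t ^ (-(1 / (θ : ℂ))), y * C t ^ (-(1 / (δ : ℂ))),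
      w * B t ^ (-(1 / (θ : ℂ)))] with hVdef
  have hV0 : V 0 = ![x, u, y, w] := by simp [hVdef, hA0, hB0, hC0]
  have hV : ∀ z ∈ Metric.ball (0 : ℂ) r, ∀ i,
      HasDerivAt (fun t => V t i) (∏ j, V z j ^ urnRM₂ θ δ lam i j) z := by
    intro z hz i
    obtain ⟨hAz, hBz, hCz⟩ := hball z hz
    fin_cases i
    · refine (hasDerivAt_mul_cpow_neg_inv (a := x) hθ' (hlin x z) hAz).congr_deriv ?_
      simp [urnRM₂, Fin.prod_univ_four, hVdef, pow_add, -one_div, mul_cpow_neg_inv_pow_self hθ, hA]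
    · refine (hasDerivAt_mul_cpow_neg_inv (a := u) hθ' (hlin x z) hAz).congr_deriv ?_
      simp [urnRM₂, Fin.prod_univ_four, hVdef, -one_div, mul_cpow_neg_inv_pow_self hθ, hA]
      ring
    · refine (hasDerivAt_mul_cpow_neg_inv (a := y) hδ' (hCd z hBz) hCz).congr_deriv ?_
      simp [urnRM₂, Fin.prod_univ_four, hVdef, pow_add, -one_div, mul_cpow_neg_inv_pow_self hδ.ne']
      ring
    · refine (hasDerivAt_mul_cpow_neg_inv (a := w) hθ' (hlin w z) hBz).congr_deriv ?_
      simp [urnRM₂, Fin.prod_univ_four, hVdef, pow_add, -one_div, mul_cpow_neg_inv_pow_self hθ, hB]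
  have hsum := hasSum_urnCount hV ![a₀, d₀, b₀, c₀] (mem_ball_zero_iff.2 hz)
  rw [hV0] at hsum
  refine ⟨hsum.summable, hsum.tsum_eq.trans ?_⟩
  have hAne : A z ≠ 0 := Complex.slitPlane_ne_zero (hball z (mem_ball_zero_iff.2 hz)).1
  change _ = x ^ a₀ * u ^ d₀ * y ^ b₀ * w ^ c₀ * A z ^ (-(((a₀ : ℂ) + (d₀ : ℂ)) / (θ : ℂ)))
    * B z ^ (-((c₀ : ℂ) / (θ : ℂ))) * C z ^ (-((b₀ : ℂ) / (δ : ℂ)))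
  rw [add_div, neg_add, Complex.cpow_add _ _ hAne, Fin.prod_univ_four]
  change (x * A z ^ (-(1 / (θ : ℂ)))) ^ a₀ * (u * A z ^ (-(1 / (θ : ℂ)))) ^ d₀
    * (y * C z ^ (-(1 / (δ : ℂ)))) ^ b₀ * (w * B z ^ (-(1 / (θ : ℂ)))) ^ c₀ = _
  simp only [mul_cpow_neg_inv_pow]
  ring
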